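/- Consider $n$ stations, named $0,\dots,n-1$, attached to a multiple access channel with jamming and without collision detection; time is divided into rounds. In each round every station either transmits one message or pauses. A message consists of control bits and at most one packet. A message is heard by all stations exactly when a single station transmits in the round and the round is not jammed; otherwise the round is void (nothing is heard), and stations cannot tell why. After this feedback, new packets may be injected into stations in the round. Each station stores its packets in an unbounded FIFO queue, initially empty; a packet leaves its queue when it is heard. Algorithm Move-Big-To-Front (MBTF): every station keeps a copy of a list of all stations, initially ordered by names, together with a token, initially held by the first station of the list. In each round exactly the station holding the token transmits: it sends the first packet of its queue, or a message with control bits only if its queue is empty, and it attaches a bit telling whether it is big, that is, has at least $n$ packets. In a void round the list and the token do not change. If the message heard comes from a big station, this station is moved to the front of the list and keeps the token; otherwise the token passes to the next station in the cyclic order of the list. For real $\rho,\lambda\ge 0$ and an integer $b>0$, a leaky-bucket jamming adversary of type $(\rho,\lambda,b)$ injects, in every contiguous segment of $t>0$ rounds, at most $\rho t+b$ packets in total and jams at most $\lambda t+b$ rounds. The latency of a packet is the number of rounds from the round of its injection through the round in which it is heard. Theorem. There is an absolute constant $C>0$ such that for every $n$, every integer $b>0$ and all reals $\rho,\lambda\ge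 0$ with $\rho+\lambda<1$, in every execution of MBTF by $n$ stations against a jamming adversary of type $(\rho,\lambda,b)$, every injected packet is eventually heard and its latency is at most $$\frac{3n(n+b)}{(1-\lambda)(1-\rho-\lambda)}+C\,\frac{bn}{1-\lambda}.$$ -/

import Mathlib

namespace MBTF

/-- A packet, identified by the round in which it is injected, the station into which it is
injected, and its index among the packets injected into that station in that round. -/
structure Packet (n : ℕ) where
  round : ℕ
  station : Fin n
  index : ℕ

/-- A message: at most one packet, together with one control bit (the "big" bit).
A message with `packet = none` consists of control bits only. -/
structure Message (n : ℕ) where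
  packet : Option (Packet n)
  big : Bool

/-- The behaviour of a jamming adversary for `n` stations: `inject r i` is the number of packets
injected into station `i` in round `r`, and `jammed r` tells whether round `r` is jammed. -/
structure Adversary (n : ℕ) where
  inject : ℕ → Fin n → ℕ
  jammed : ℕ → Bool

/-- The leaky-bucket jamming constraints of type `(ρ, lam, b)`: in each contiguous segment
`s, …, s + t - 1` of `t > 0` rounds, at most `ρ * t + b` packets are injected (into all stations
together) and at most `lam * t + b` rounds are jammed. -/
def Adversary.IsOfType {n : ℕ} (A : Adversary n) (ρ lam : ℝ) (b : ℕ) : Prop :=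
  ∀ s t : ℕ, 0 < t →
    ((∑ r ∈ Finset.Ico s (s + t), ∑ i : Fin n, A.inject r i : ℕ) : ℝ) ≤ ρ * t + b ∧
    (((Finset.Ico s (s + t)).filter (fun r => A.jammed r = true)).card : ℝ) ≤ lam * t + b

/-- The packets injected into station `i` in round `r`, in the order in which they are enqueued. -/
def Adversary.newPackets {n : ℕ} (A : Adversary n) (r : ℕ) (i : Fin n) : List (Packet n) :=
  (List.range (A.inject r i)).map (fun k => ⟨r, i, k⟩)

/-- Multiple access channel with jamming and without collision detection. Given what each station
transmits (`none` means that it pauses), the feedback received by all stations is the transmitted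
message if the round is clear and exactly one station transmits; otherwise the round is void
(`none`). -/
def channel {n : ℕ} (jammed : Bool) (tx : Fin n → Option (Message n)) : Option (Message n) :=
  match jammed, (List.finRange n).filterMap tx with
  | false, [m] => some m
  | _, _ => none

/-- The state of one station: its private copy of the list of stations, the position in that list
of the station holding the token (positions are counted from `0`), and its FIFO queue of packets
(the oldest packet first). -/
structure Station (n : ℕ) where
  list : List (Fin n)
  token : ℕ
  queue : List (Packet n)

/-- Initially the list is sorted by names, the first station has the token, queues are empty. -/
def Station.init (n : ℕ) : Station n where
  list := List.finRange n
  token := 0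
  queue := []

/-- The station that holds the token, according to the given station. -/
def Station.holder {n : ℕ} (s : Station n) : Option (Fin n) :=
  s.list[s.token]?

/-- What station `i` in state `s` transmits: it transmits iff it holds the token; the message
carries the first packet of its queue (no packet if the queue is empty) and a bit that tells
whether the station is big, that is, has at least `n` packets. -/
def Station.transmit {n : ℕ} (i : Fin n) (s : Station n) : Option (Message n) :=
  if s.holder = some i then
    some { packet := s.queue.head?, big := decide (n ≤ s.queue.length) }
  else
    none

/-- The list and the token after the feedback of the round. In a void round nothing changes.
If a message of a big station is heard, this station (the token holder) is moved to the front of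
the list and keeps the token; if any other message is heard, the token passes to the next
station in the cyclic order of the list. -/
def Station.updateList {n : ℕ} (s : Station n) (feedback : Option (Message n)) :
    List (Fin n) × ℕ :=
  match feedback, s.holder with
  | some m, some h =>
    if m.big then (h :: s.list.erase h, 0) else (s.list, (s.token + 1) % n)
  | _, _ => (s.list, s.token)

/-- The queue after a round: a packet just transmitted successfully by this station is
discarded, and the packets injected in the round are enqueued. -/
def Station.updateQueue {n : ℕ} (i : Fin n) (s : Station n) (feedback : Option (Message n))
    (new : List (Packet n)) : List (Packet n) :=
  (if (s.transmit i).isSome && feedback.isSome then s.queue.tail else s.queue) ++ new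

/-- The state transition of station `i` at the end of a round. -/
def Station.next {n : ℕ} (i : Fin n) (s : Station n) (feedback : Option (Message n))
    (new : List (Packet n)) : Station n where
  list := (s.updateList feedback).1
  token := (s.updateList feedback).2
  queue := s.updateQueue i feedback new

/-- The feedback in round `r` when the stations are in the states `S` at its beginning. -/
def feedback {n : ℕ} (A : Adversary n) (r : ℕ) (S : Fin n → Station n) : Option (Message n) :=
  channel (A.jammed r) (fun i => (S i).transmit i)

/-- The execution of Move-Big-To-Front against `A`: the states of all stations at the beginning of
round `r` (rounds are numbered from `0`). -/
def run {n : ℕ} (A : Adversary n) : ℕ → Fin n → Station n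
  | 0 => fun _ => Station.init n
  | r + 1 => fun i =>
      (run A r i).next i (feedback A r (run A r)) (A.newPackets r i)

/-- Packet `p` is heard on the channel in round `r`. -/
def HeardAt {n : ℕ} (A : Adversary n) (p : Packet n) (r : ℕ) : Prop :=
  ∃ m : Message n, feedback A r (run A r) = some m ∧ m.packet = some p

/-- Every packet injected is heard on the channel, and the number of rounds from the round of its
injection through the round in which it is heard, both included, is at most `L`. -/
def PacketLatencyAtMost {n : ℕ} (A : Adversary n) (L : ℝ) : Prop :=
  ∀ (r : ℕ) (i : Fin n), ∀ p ∈ A.newPackets r i,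
    ∃ s : ℕ, r ≤ s ∧ HeardAt A p s ∧ (s : ℝ) - r + 1 ≤ L

end MBTF

namespace MBTF

open Finset

/-! ### Lists -/

/-! Take a packet injected in round r and still unheard before round t, and let s ≤ r be the last
round at whose beginning no station is big, so that at most n(n - 1) packets are queued at s. Every
unjammed round in [s, t) removes a packet unless the token holder is empty (a wasted round). Hence t
- s is less than the number of packets queued at s, plus injections, jammed rounds and wasted rounds
(`sum_qlen_eq`). The adversary contributes at most (ρ + λ)(t - s) + 2b, so it remains to bound the
waste.

A station wastes at most n - 1 rounds more than the token wraps around the list (`wasted_le`):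
between wraps it is passed again only after big stations have overtaken it, and each of these pushes
it back by a position. Up to and including round r there is at most one wrap, since the token cannot
get past a big station (`wraps_of_big`). Afterwards each wrap passes the waiting packet's station
while it is small, which brings the packet nearer to the head of its queue (`wraps_of_waiting`). In
all there are at most n + 1 wraps, so at most 2n² wasted rounds, and (1 - ρ - λ)(t - r) + 1 ≤ 3n² +
2b - n. This already fits under the first term of the claimed bound. -/

theorem filterMap_ite_eq_singleton {α β : Type*} [DecidableEq α] (f : α → β) (h : α) :
    ∀ l : List α, l.Nodup → h ∈ l →
      l.filterMap (fun i => if h = i then some (f i) else none) = [f h]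
  | [], _, hm => by simp at hm
  | a :: l, hn, hm => by
      rw [List.nodup_cons] at hn
      by_cases ha : h = a
      · subst ha
        have : l.filterMap (fun i => if h = i then some (f i) else none) = [] := by
          rw [List.filterMap_eq_nil_iff]
          intro x hx
          have : h ≠ x := fun e => hn.1 (e ▸ hx)
          simp [this]
        simp [this]
      · have hm' : h ∈ l := by simpa [ha] using hm
        simp [ha, filterMap_ite_eq_singleton f h l hn.2 hm']

theorem idxOf_cons_erase {α : Type*} [DecidableEq α] {h j : α} (hj : h ≠ j) (l : List α)
    (hm : h ∈ l) :
    (h :: l.erase h).idxOf j =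
      if l.idxOf j < l.idxOf h then l.idxOf j + 1 else l.idxOf j := by
  rw [List.idxOf_cons_ne _ hj]
  induction l with
  | nil => simp at hm
  | cons a l ih =>
    by_cases ha : a = h
    · subst ha
      simp [List.idxOf_cons_ne _ hj]
    · have hm' : h ∈ l := by simpa [Ne.symm ha] using hm
      rw [List.erase_cons_tail (by simpa using ha), List.idxOf_cons_ne _ ha]
      by_cases hb : a = j
      · subst hb; simp
      · rw [List.idxOf_cons_ne _ hb, List.idxOf_cons_ne _ hb]
        have := ih hm'
        split_ifs at this ⊢ <;> omega

/-! ### One round of the execution -/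

section

variable {n : ℕ} (A : Adversary n)

/-- The position of station `j` in its copy of the list at the beginning of round `r`. -/
def pos (r : ℕ) (j : Fin n) : ℕ := (run A r j).list.idxOf j

/-- The position of the token according to station `i` at the beginning of round `r`. -/
def tok (r : ℕ) (i : Fin n) : ℕ := (run A r i).token

/-- The number of packets queued in station `j` at the beginning of round `r`. -/
def qlen (r : ℕ) (j : Fin n) : ℕ := (run A r j).queue.length

/-- Station `j` is heard in round `r`. -/
def Served (r : ℕ) (j : Fin n) : Prop := A.jammed r = false ∧ (run A r j).holder = some j

/-- Station `j` is heard in round `r`, with control bits only. -/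
def Wasted (r : ℕ) (j : Fin n) : Prop := Served A r j ∧ qlen A r j = 0

/-- In round `r` the token moves from the end of the list to its front. -/
def Wrap (r : ℕ) : Prop := ∃ j, Served A r j ∧ qlen A r j < n ∧ pos A r j + 1 = n

/-- The update of list and token reads only these two and the shared feedback, never the queue, so
equal copies stay equal; a dummy empty queue can stand in for the real one. -/
theorem run_common (r : ℕ) (i₀ : Fin n) : ∃ (l : List (Fin n)) (k : ℕ),
    l.Perm (List.finRange n) ∧ k < n ∧ ∀ i, (run A r i).list = l ∧ (run A r i).token = k := by
  induction r with
  | zero => exact ⟨_, 0, .refl _, i₀.pos, fun i => ⟨rfl, rfl⟩⟩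
  | succ r ih =>
    obtain ⟨l, k, hl, hk, h⟩ := ih
    have key : ∀ i, (run A (r + 1) i).list =
          ((⟨l, k, []⟩ : Station n).updateList (feedback A r (run A r))).1 ∧
        (run A (r + 1) i).token =
          ((⟨l, k, []⟩ : Station n).updateList (feedback A r (run A r))).2 := by
      intro i
      obtain ⟨h1, h2⟩ := h i
      simp only [run, Station.next, Station.updateList, Station.holder, h1, h2, and_self]
    refine ⟨_, _, ?_, ?_, key⟩
    · unfold Station.updateList
      split
      · next m x hx _ =>
        split_ifs
        · have hx : l[k]? = some x := by assumption
          exact (List.perm_cons_erase (List.mem_of_getElem? hx)).symm.trans hl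
        · exact hl
      · exact hl
    · unfold Station.updateList
      split
      · split_ifs
        · exact i₀.pos
        · exact Nat.mod_lt _ i₀.pos
      · exact hk

theorem pos_lt (r : ℕ) (j : Fin n) : pos A r j < n := by
  obtain ⟨l, k, hl, hk, h⟩ := run_common A r j
  have : j ∈ l := hl.mem_iff.2 (List.mem_finRange j)
  simpa [pos, (h j).1, hl.length_eq] using List.idxOf_lt_length_of_mem this

theorem tok_lt (r : ℕ) (i : Fin n) : tok A r i < n := by
  obtain ⟨l, k, hl, hk, h⟩ := run_common A r i
  simpa [tok, (h i).2] using hk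

/-- The three ways in which a round `r` may change the list and the token, held by `h`. -/
inductive Move (r : ℕ) (i h : Fin n) : Prop
  | void (hjam : A.jammed r = true) (hpos : ∀ j, pos A (r + 1) j = pos A r j)
      (htok : tok A (r + 1) i = tok A r i) : Move r i h
  | big (hjam : A.jammed r = false) (hbig : n ≤ qlen A r h) (hpos : pos A (r + 1) h = 0)
      (hlt : ∀ j, pos A r j < pos A r h → pos A (r + 1) j = pos A r j + 1)
      (hgt : ∀ j, pos A r h < pos A r j → pos A (r + 1) j = pos A r j)
      (htok : tok A (r + 1) i = 0) : Move r i h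
  | small (hjam : A.jammed r = false) (hsmall : qlen A r h < n)
      (hpos : ∀ j, pos A (r + 1) j = pos A r j)
      (htok : tok A r i + 1 < n → tok A (r + 1) i = tok A r i + 1)
      (hwrap : tok A r i + 1 = n → tok A (r + 1) i = 0) : Move r i h

open Classical in
-- Interface to the protocol: later arguments use only positions, the token position, queues and
-- `HeardAt`.
theorem exists_move (r : ℕ) (i : Fin n) : ∃ h : Fin n,
    Move A r i h ∧ pos A r h = tok A r i ∧ (∀ j, pos A r j = tok A r i → j = h) ∧
    (∀ j, Served A r j ↔ A.jammed r = false ∧ j = h) ∧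
    (∀ j, (run A (r + 1) j).queue =
      (if Served A r j then (run A r j).queue.tail else (run A r j).queue) ++ A.newPackets r j) ∧
    (A.jammed r = false → ∀ p, (run A r h).queue.head? = some p → HeardAt A p r) := by
  obtain ⟨l, k, hl, hk, hc⟩ := run_common A r i
  have hlen : l.length = n := by simpa using hl.length_eq
  have hnd : l.Nodup := hl.nodup_iff.2 (List.nodup_finRange n)
  have hmem : ∀ j, j ∈ l := fun j => hl.mem_iff.2 (List.mem_finRange j)
  have hkl : k < l.length := hk.trans_eq hlen.symm
  obtain ⟨h, hh⟩ : ∃ h, l[k] = h := ⟨_, rfl⟩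
  have hhold : ∀ j, (run A r j).holder = some h := by
    intro j
    rw [Station.holder, (hc j).1, (hc j).2, List.getElem?_eq_getElem hkl, hh]
  have hidx : l.idxOf h = k := by rw [← hh]; exact hnd.idxOf_getElem k hkl
  have hpos : ∀ j, pos A r j = l.idxOf j := fun j => by rw [pos, (hc j).1]
  have htok : tok A r i = k := (hc i).2
  have hserved : ∀ j, Served A r j ↔ A.jammed r = false ∧ j = h := by
    intro j
    rw [Served, hhold j, Option.some_inj, eq_comm (a := h)]
  have hinj : ∀ j, l.idxOf j = k → j = h := by
    intro j hj
    exact (List.idxOf_inj (hmem j)).1 (hj.trans hidx.symm)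
  have hfb : feedback A r (run A r) = if A.jammed r = true then none else
      some ⟨(run A r h).queue.head?, decide (n ≤ (run A r h).queue.length)⟩ := by
    have : (List.finRange n).filterMap (fun j => (run A r j).transmit j) =
        [⟨(run A r h).queue.head?, decide (n ≤ (run A r h).queue.length)⟩] := by
      rw [← filterMap_ite_eq_singleton (fun j => (⟨(run A r j).queue.head?,
        decide (n ≤ (run A r j).queue.length)⟩ : Message n)) h _ (List.nodup_finRange n)
        (List.mem_finRange h)]
      congr 1
      funext j
      simp [Station.transmit, hhold j]
    cases hjam : A.jammed r <;> simp [feedback, channel, this, hjam]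
  have hlist : ∀ j, (run A (r + 1) j).list = if A.jammed r = true then l else
      if n ≤ qlen A r h then h :: l.erase h else l := by
    intro j
    change ((run A r j).updateList (feedback A r (run A r))).1 = _
    rw [hfb]
    by_cases hjam : A.jammed r = true <;> by_cases hb : n ≤ (run A r h).queue.length <;>
      simp [Station.updateList, hhold j, (hc j).1, (hc j).2, hjam, hb, qlen]
  have htok' : ∀ j, (run A (r + 1) j).token = if A.jammed r = true then k else
      if n ≤ qlen A r h then 0 else (k + 1) % n := by
    intro j
    change ((run A r j).updateList (feedback A r (run A r))).2 = _
    rw [hfb]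
    by_cases hjam : A.jammed r = true <;> by_cases hb : n ≤ (run A r h).queue.length <;>
      simp [Station.updateList, hhold j, (hc j).1, (hc j).2, hjam, hb, qlen]
  have hpos' : ∀ j, pos A (r + 1) j = (if A.jammed r = true then l else
      if n ≤ qlen A r h then h :: l.erase h else l).idxOf j := fun j => by rw [pos, hlist]
  have htok'' := htok' i
  change tok A (r + 1) i = _ at htok''
  refine ⟨h, ?_, by rw [hpos, htok, hidx], fun j hj => hinj j (by rw [← hpos, hj, htok]),
    hserved, ?_, ?_⟩
  · by_cases hjam : A.jammed r = true
    · simp only [hjam, if_true] at hpos' htok''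
      exact .void hjam (fun j => by rw [hpos', hpos]) (by rw [htok'', htok])
    · simp only [hjam] at hpos' htok''
      have hjam' : A.jammed r = false := by simpa using hjam
      by_cases hb : n ≤ qlen A r h
      · simp only [hb, if_true] at hpos' htok''
        refine .big hjam' hb (by simp [hpos']) ?_ ?_ (by simpa using htok'')
        · intro j hj
          rw [hpos, hpos] at hj
          have hne : h ≠ j := fun e => by simp [e] at hj
          rw [hpos', hpos]
          simpa [hj] using idxOf_cons_erase hne l (hmem h)
        · intro j hj
          rw [hpos, hpos] at hj
          have hne : h ≠ j := fun e => by simp [e] at hj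
          rw [hpos', hpos]
          simpa [hj.not_gt] using idxOf_cons_erase hne l (hmem h)
      · simp only [hb] at hpos' htok''
        refine .small hjam' (not_le.1 hb) (fun j => by rw [hpos', hpos]; simp) ?_ ?_
        · intro hlt
          rw [htok] at hlt ⊢
          simpa [Nat.mod_eq_of_lt hlt] using htok''
        · intro heq
          rw [htok] at heq
          simpa [heq] using htok''
  · intro j
    change (run A r j).updateQueue j (feedback A r (run A r)) (A.newPackets r j) = _
    rw [Station.updateQueue, hfb]
    by_cases hjam : A.jammed r = true <;> by_cases hj : h = j <;>
      simp [hjam, hj, hserved, Station.transmit, hhold j, eq_comm]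
  · intro hjam p hp
    exact ⟨_, by rw [hfb, hjam]; rfl, hp⟩

theorem wrap_iff {r : ℕ} {i h : Fin n} (hs : ∀ j, Served A r j ↔ A.jammed r = false ∧ j = h)
    (hp : pos A r h = tok A r i) :
    Wrap A r ↔ A.jammed r = false ∧ qlen A r h < n ∧ tok A r i + 1 = n := by
  simp only [Wrap, hs, ← hp]
  constructor
  · rintro ⟨j, ⟨h1, rfl⟩, h2⟩
    exact ⟨h1, h2⟩
  · rintro ⟨h1, h2⟩
    exact ⟨h, ⟨h1, rfl⟩, h2⟩

open Classical in
-- Written additively to avoid truncated subtraction: serving an empty queue removes nothing, so the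
-- `Wasted` term cancels the `Served` term.
theorem qlen_succ (r : ℕ) (j : Fin n) :
    qlen A (r + 1) j + (if Served A r j then 1 else 0) =
      qlen A r j + A.inject r j + (if Wasted A r j then 1 else 0) := by
  obtain ⟨h, -, -, -, -, hq, -⟩ := exists_move A r j
  have hnew : (A.newPackets r j).length = A.inject r j := by simp [Adversary.newPackets]
  have := congrArg List.length (hq j)
  rw [List.length_append, hnew] at this
  by_cases hs : Served A r j
  · by_cases h0 : qlen A r j = 0 <;>
      simp only [Wasted, hs, h0, true_and, if_true, if_false, List.length_tail] at this ⊢ <;>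
      simp only [qlen] at this h0 ⊢ <;> omega
  · simp only [Wasted, hs, false_and, if_false] at this ⊢
    simp only [qlen] at this ⊢
    omega

/-! ### Counting wasted rounds -/

open Classical in
/-- The number of rounds in `[s, t)` with property `P`. -/
noncomputable def count (P : ℕ → Prop) (s t : ℕ) : ℕ := ∑ r ∈ Ico s t, if P r then 1 else 0

theorem count_self (P : ℕ → Prop) (s : ℕ) : count P s s = 0 := by simp [count]

open Classical in
theorem count_succ (P : ℕ → Prop) {s t : ℕ} (h : s ≤ t) :
    count P s (t + 1) = count P s t + if P t then 1 else 0 := by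
  rw [count, Finset.sum_Ico_succ_top h, count]

/-- Potential argument. When the token passes j, the indicator pays for the wasted round or lost
packet. It is reset by a wrap, which is counted, or by a big station moving from behind j to the
front, which increases the position of j. The two bounds need each other, so they are proved
together. -/
theorem wasted_le (i j : Fin n) {s t : ℕ} (hst : s ≤ t) :
    count (Wasted A · j) s t + 1 ≤ n + count (Wrap A) s t ∧
    count (Wasted A · j) s t ≤ count (Wrap A) s t + pos A t j +
      (if pos A t j < tok A t i then 1 else 0) + qlen A t j := by
  induction t, hst using Nat.le_induction with
  | base =>
    have := i.pos
    simp only [count_self]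
    omega
  | succ t hst ih =>
    rw [count_succ _ hst, count_succ _ hst]
    obtain ⟨h, hm, hp, hinj, hs, -, -⟩ := exists_move A t i
    have hw := wrap_iff A hs hp
    have hq := qlen_succ A t j
    have hsj := hs j
    have hwj : Wasted A t j ↔ Served A t j ∧ qlen A t j = 0 := Iff.rfl
    have hk := tok_lt A t i
    have hpj := pos_lt A t j
    have hne := hinj j
    by_cases hjh : j = h
    · subst hjh
      cases hm with
      | void hjam hpos htok =>
        simp only [hjam, hpos, htok] at *
        simp_all
        omega
      -- Here j loses its position, but it keeps at least n - 1 packets, so the first bound restores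
      -- the second.
      | big hjam hbig hpos hlt hgt htok =>
        have h0 : ¬ qlen A t j = 0 := by omega
        have h1 : ¬ qlen A t j < n := by omega
        simp [hwj, hw, hsj, hjam, h0, h1, hpos, htok] at *
        omega
      -- If j is empty, the second bound with position at most n - 1 yields the first; at position n
      -- - 1 the round is itself a wrap.
      | small hjam hsmall hpos htok hwrap =>
        simp only [hwj, hw, hsj, hjam, hsmall, hpos, hp, true_and, and_self] at *
        split_ifs at * <;> omega
    · have hne' : pos A t j ≠ tok A t i := fun e => hjh (hne e)
      cases hm with
      | void hjam hpos htok =>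
        simp [hwj, hw, hsj, hjam, hpos, htok] at *
        omega
      | big hjam hbig hpos hlt hgt htok =>
        have h1 : ¬ qlen A t h < n := by omega
        have := hlt j
        have := hgt j
        simp [hwj, hw, hsj, hjam, hjh, h1, htok] at *
        split_ifs at * <;> omega
      | small hjam hsmall hpos htok hwrap =>
        simp [hwj, hw, hsj, hjam, hjh, hsmall, hpos] at *
        split_ifs at * <;> omega

/-! ### Counting the traversals of the list -/

/-- After a wrap, or after a move to the front, the token is at position 0, so any big station lies
at or behind it. Such a station stays big until the token reaches it, and then sends the token back
to the front without a wrap. -/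
theorem wraps_of_big (i : Fin n) {s t : ℕ} (hst : s ≤ t)
    (hbig : ∀ u, s < u → u ≤ t → ∃ j, n ≤ qlen A u j) :
    count (Wrap A) s t = 0 ∨
      count (Wrap A) s t = 1 ∧ ∃ j, n ≤ qlen A t j ∧ tok A t i ≤ pos A t j := by
  induction t, hst using Nat.le_induction with
  | base => exact .inl (count_self _ _)
  | succ t hst ih =>
    specialize ih fun u h1 h2 => hbig u h1 (by omega)
    rw [count_succ _ hst]
    obtain ⟨h, hm, hp, hinj, hs, -, -⟩ := exists_move A t i
    have hw := wrap_iff A hs hp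
    obtain ⟨x, hx⟩ := hbig (t + 1) (by omega) le_rfl
    cases hm with
    | void hjam hpos htok =>
      simp only [hw, hjam] at *
      rcases ih with ih | ⟨ih, j, hj, hj'⟩
      · exact .inl (by simpa using ih)
      · refine .inr ⟨by simpa using ih, j, ?_, by rw [htok, hpos]; exact hj'⟩
        have := qlen_succ A t j
        simp [hs, Wasted] at this
        omega
    | big hjam hbig hpos hlt hgt htok =>
      have h1 : ¬ qlen A t h < n := by omega
      simp only [hw, h1, false_and, and_false, if_false, add_zero]
      rcases ih with ih | ⟨ih, -⟩
      · exact .inl ih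
      · exact .inr ⟨ih, x, hx, by omega⟩
    | small hjam hsmall hpos htok hwrap =>
      have hk := tok_lt A t i
      rcases ih with ih | ⟨ih, j, hj, hj'⟩
      · by_cases hk' : tok A t i + 1 = n
        · exact .inr ⟨by simp [hw, ih, hjam, hsmall, hk'], x, hx, by rw [hwrap hk']; omega⟩
        · exact .inl (by simp [hw, ih, hk'])
      -- The holder is small, so the big station j is strictly behind the token, which therefore is
      -- not at the end of the list.
      · have hne : j ≠ h := fun e => by subst e; omega
        have hne' : pos A t j ≠ tok A t i := fun e => hne (hinj j e)
        have hpj := pos_lt A t j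
        have hk' : ¬ tok A t i + 1 = n := by omega
        refine .inr ⟨by simp [hw, ih, hk'], j, ?_, by rw [htok (by omega), hpos]; omega⟩
        have := qlen_succ A t j
        simp [hs, Wasted, hne] at this
        omega

/-- Covers one more round, after which no station need be big: a second wrap in round t would need a
small holder in the last position, but the big station at or behind the token would be that holder.
-/
theorem wraps_succ_le_one (i : Fin n) {s t : ℕ} (hst : s ≤ t)
    (hbig : ∀ u, s < u → u ≤ t → ∃ j, n ≤ qlen A u j) : count (Wrap A) s (t + 1) ≤ 1 := by
  rw [count_succ _ hst]
  rcases wraps_of_big A i hst hbig with h0 | ⟨h0, j, hj, hj'⟩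
  · rw [h0]; split_ifs <;> omega
  · have : ¬ Wrap A t := by
      obtain ⟨h, hm, hp, hinj, hs, -, -⟩ := exists_move A t i
      rw [wrap_iff A hs hp]
      rintro ⟨-, h1, h2⟩
      have hpj := pos_lt A t j
      have := hinj j (by omega)
      subst this
      omega
    simp [h0, this]

/-- While a packet waits in station `i`, the token traverses the list at most about `n` times. -/
theorem wraps_of_waiting {i : Fin n} {p : Packet n} {s r t : ℕ} (hsr : s ≤ r) (hrt : r < t)
    (hp : p ∈ A.newPackets r i) (hbig : ∀ u, s < u → u ≤ r → ∃ j, n ≤ qlen A u j)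
    (hwait : ∀ u, r < u → u < t → ¬ HeardAt A p u) :
    ∃ pre suf, (run A t i).queue = pre ++ p :: suf ∧
      count (Wrap A) s t + min (pre.length + 1) n + (if pos A t i < tok A t i then 1 else 0)
        ≤ n + 2 := by
  -- The left side never increases: a wrap is paid for by the indicator, or by the queue term if the
  -- station itself is last and small. The cap at n lets the station be big at no cost.
  induction t, hrt using Nat.le_induction with
  | base =>
    have h1 : count (Wrap A) s r.succ ≤ 1 := wraps_succ_le_one A i hsr hbig
    obtain ⟨h, -, -, -, -, hq, -⟩ := exists_move A r i
    have hmem : p ∈ (run A (r + 1) i).queue := by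
      rw [hq i]; exact List.mem_append_right _ hp
    obtain ⟨pre, suf, hps⟩ := List.append_of_mem hmem
    -- The constant n + 2 is one wrap, the cap n, and the indicator.
    exact ⟨pre, suf, hps, by split_ifs <;> omega⟩
  | succ t hrt ih =>
    obtain ⟨pre, suf, hps, hle⟩ := ih fun u h1 h2 => hwait u h1 (by omega)
    have hnot := hwait t hrt (by omega)
    rw [count_succ _ (by omega)]
    obtain ⟨h, hm, hpos, hinj, hs, hq, hheard⟩ := exists_move A t i
    have hw := wrap_iff A hs hpos
    have hk := tok_lt A t i
    have hpi := pos_lt A t i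
    have hlen : qlen A t i = pre.length + 1 + suf.length := by
      rw [qlen, hps]; simp; omega
    by_cases hih : i = h
    · subst hih
      by_cases hjam : A.jammed t = true
      · cases hm with
        | void hjam hpos' htok =>
          refine ⟨pre, suf ++ A.newPackets t i, by rw [hq i]; simp [hs, hjam, hps], ?_⟩
          simp only [hw, hjam, hpos', htok] at *
          simpa using hle
        | big hjam' => simp [hjam] at hjam'
        | small hjam' => simp [hjam] at hjam'
      · have hjam' : A.jammed t = false := by simpa using hjam
        cases pre with
        -- With nothing ahead of it, the packet would be heard in this round.
        | nil => exact absurd (hheard hjam' p (by simp [hps])) hnot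
        | cons a pre =>
          refine ⟨pre, suf ++ A.newPackets t i, by rw [hq i]; simp [hs, hjam', hps], ?_⟩
          rw [List.length_cons] at hle hlen
          cases hm with
          | void hjam' => simp [hjam'] at hjam
          | big hjam hbig' hpos' hlt hgt htok =>
            simp only [hw, hjam', hpos', htok] at *
            split_ifs at * <;> omega
          -- A small queue is below the cap, so the minimum really drops by one, paying for the
          -- indicator or the wrap.
          | small hjam hsmall hpos' htok hwrap =>
            rw [if_neg (by omega)] at hle
            simp only [hw, hjam', hpos', hsmall, true_and]
            split_ifs <;> omega
    · have hne : pos A t i ≠ tok A t i := fun e => hih (hinj i e)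
      refine ⟨pre, suf ++ A.newPackets t i, by rw [hq i]; simp [hs, hih, hps], ?_⟩
      cases hm with
      | void hjam hpos' htok =>
        simp only [hw, hjam, hpos', htok] at *
        simpa using hle
      | big hjam hbig' hpos' hlt hgt htok =>
        have h1 : ¬ qlen A t h < n := by omega
        simp only [hw, h1, htok, false_and, and_false, if_false] at *
        split_ifs at * <;> omega
      | small hjam hsmall hpos' htok hwrap =>
        simp only [hw, hjam, hsmall, hpos', true_and] at *
        split_ifs at * <;> omega

/-! ### The latency bound -/

open Classical in
-- Packet balance: each unjammed round serves exactly one station. The station `i₀` only ensures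
-- that some station exists.
theorem sum_qlen_eq (i₀ : Fin n) {s t : ℕ} (hst : s ≤ t) :
    ∑ j, qlen A t j + (t - s) =
      ∑ j, qlen A s j + ∑ r ∈ Ico s t, ∑ j, A.inject r j + ∑ j, count (Wasted A · j) s t +
        ((Ico s t).filter (fun r => A.jammed r = true)).card := by
  induction t, hst using Nat.le_induction with
  | base => simp [count_self]
  | succ t hst ih =>
    have h1 : ∑ j, qlen A (t + 1) j + (if A.jammed t = true then 0 else 1) =
        ∑ j, qlen A t j + ∑ j, A.inject t j + ∑ j, (if Wasted A t j then 1 else 0) := by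
      rw [← sum_add_distrib, ← sum_add_distrib, ← sum_congr rfl fun j _ => qlen_succ A t j,
        sum_add_distrib]
      congr 1
      obtain ⟨h, -, -, -, hs, -, -⟩ := exists_move A t i₀
      cases hjam : A.jammed t <;> simp [hs, hjam]
    have h2 : ∑ j, count (Wasted A · j) s (t + 1) =
        ∑ j, count (Wasted A · j) s t + ∑ j, (if Wasted A t j then 1 else 0) := by
      rw [← sum_add_distrib]
      exact sum_congr rfl fun j _ => count_succ _ hst
    have h3 : ((Ico s (t + 1)).filter (fun r => A.jammed r = true)).card =
        ((Ico s t).filter (fun r => A.jammed r = true)).card +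
          if A.jammed t = true then 1 else 0 := by
      rw [card_filter, Finset.sum_Ico_succ_top hst, card_filter]
    rw [h2, h3, Finset.sum_Ico_succ_top hst]
    split_ifs at h1 ⊢ <;> omega

theorem time_le_of_waiting {b : ℕ} {ρ lam : ℝ} (hA : A.IsOfType ρ lam b) {i : Fin n}
    {p : Packet n} {r t : ℕ} (hrt : r < t) (hp : p ∈ A.newPackets r i)
    (hρ : ρ + lam < 1)
    (hwait : ∀ u, r < u → u < t → ¬ HeardAt A p u) :
    (1 - ρ - lam) * ((t : ℝ) - r) + 1 ≤ 3 * n * n + 2 * b - n := by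
  classical
  have hn := i.pos
  -- The last round up to r without big stations; round 0 qualifies because all queues are empty.
  obtain ⟨s, hsr, hsmall, hbig⟩ : ∃ s ≤ r, (∀ j, qlen A s j < n) ∧
      ∀ u, s < u → u ≤ r → ∃ j, n ≤ qlen A u j := by
    refine ⟨Nat.findGreatest (fun s => ∀ j, qlen A s j < n) r, Nat.findGreatest_le r,
      Nat.findGreatest_spec (P := fun s => ∀ j, qlen A s j < n) (Nat.zero_le r)
        (fun j => by simpa [qlen, run, Station.init] using hn), fun u h1 h2 => ?_⟩
    simpa using Nat.findGreatest_is_greatest h1 h2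
  obtain ⟨pre, suf, hq, hwr⟩ := wraps_of_waiting A hsr hrt hp hbig hwait
  -- The capped queue term is at least 1, because it counts the waiting packet itself.
  have hV : count (Wrap A) s t ≤ n + 1 := by omega
  have hW : ∑ j, count (Wasted A · j) s t ≤ n * (2 * n) := by
    have : ∀ j ∈ (univ : Finset (Fin n)), count (Wasted A · j) s t ≤ 2 * n := fun j _ => by
      have := (wasted_le A i j (hsr.trans hrt.le)).1
      omega
    simpa using sum_le_card_nsmul _ _ _ this
  have hQ : ∑ j, qlen A s j + n ≤ n * n := by
    have : ∀ j ∈ (univ : Finset (Fin n)), qlen A s j + 1 ≤ n := fun j _ => hsmall j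
    simpa [sum_add_distrib] using sum_le_card_nsmul _ _ _ this
  have hQt : 1 ≤ ∑ j, qlen A t j := by
    refine le_trans ?_ (single_le_sum (fun j _ => Nat.zero_le (qlen A t j)) (mem_univ i))
    rw [qlen, hq, List.length_append, List.length_cons]; omega
  have hbal := sum_qlen_eq A i (hsr.trans hrt.le)
  obtain ⟨hin, hja⟩ := hA s (t - s) (by omega)
  rw [Nat.add_sub_cancel' (hsr.trans hrt.le)] at hin hja
  have hts : ((t - s : ℕ) : ℝ) = t - s := Nat.cast_sub (hsr.trans hrt.le)
  have hW' : ((∑ j, count (Wasted A · j) s t : ℕ) : ℝ) ≤ n * (2 * n) := by exact_mod_cast hW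
  have hQ' : ((∑ j, qlen A s j : ℕ) : ℝ) + n ≤ n * n := by exact_mod_cast hQ
  have hQt' : (1 : ℝ) ≤ ((∑ j, qlen A t j : ℕ) : ℝ) := by exact_mod_cast hQt
  have hbal' := congrArg (Nat.cast : ℕ → ℝ) hbal
  rw [Nat.cast_add, Nat.cast_add, Nat.cast_add, Nat.cast_add, hts] at hbal'
  rw [hts] at hin hja
  have hmono : (1 - ρ - lam) * ((t : ℝ) - r) ≤ (1 - ρ - lam) * ((t : ℝ) - s) := by
    have : (s : ℝ) ≤ r := by exact_mod_cast hsr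
    exact mul_le_mul_of_nonneg_left (by linarith) (by linarith)
  linarith

end

end MBTF

theorem mainTheorem1 :
    ∃ C : ℝ, 0 < C ∧
      ∀ (n b : ℕ) (ρ lam : ℝ), 0 < b → 0 ≤ ρ → 0 ≤ lam → ρ + lam < 1 →
        ∀ A : MBTF.Adversary n, A.IsOfType ρ lam b →
          MBTF.PacketLatencyAtMost A
            (3 * n * (n + b) / ((1 - lam) * (1 - ρ - lam)) + C * (b * n / (1 - lam))) := by
  classical
  -- Any positive constant works: the second term is used only through its sign.
  refine ⟨1, one_pos, fun n b ρ lam hb hρ hlam hlt A hA r i p hp => ?_⟩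
  have hε : 0 < 1 - ρ - lam := by linarith
  have hex : ∃ s, r < s ∧ MBTF.HeardAt A p s := by
    by_contra! hno
    obtain ⟨m, hm⟩ := exists_nat_gt ((3 * n * n + 2 * b - n : ℝ) / (1 - ρ - lam))
    rw [div_lt_iff₀ hε] at hm
    have := MBTF.time_le_of_waiting A hA (t := r + (m + 1)) (by omega) hp hlt
      fun u h1 _ => hno u h1
    push_cast at this
    linarith
  obtain ⟨hrs, hheard⟩ := Nat.find_spec hex
  refine ⟨Nat.find hex, hrs.le, hheard, ?_⟩
  have hle := MBTF.time_le_of_waiting A hA hrs hp hlt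
    fun u h1 h2 h3 => Nat.find_min hex h2 ⟨h1, h3⟩
  have hn : (1 : ℝ) ≤ n := by exact_mod_cast i.pos
  have hb' : (1 : ℝ) ≤ b := by exact_mod_cast hb
  have hnb : (b : ℝ) ≤ n * b := le_mul_of_one_le_left (by linarith) hn
  have hlam1 : 0 < 1 - lam := by linarith
  -- The extra round in the latency costs 1 - ρ - λ ≤ 1 after multiplication, and 2b ≤ 3nb; the
  -- factor 1 - λ ≤ 1 in the denominator only weakens the bound.
  calc ((Nat.find hex : ℕ) : ℝ) - r + 1 ≤ 3 * n * (n + b) / (1 - ρ - lam) := by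
        rw [le_div_iff₀ hε]
        linarith
    _ ≤ 3 * n * (n + b) / ((1 - lam) * (1 - ρ - lam)) := by
        refine div_le_div_of_nonneg_left (by positivity) (by positivity) ?_
        exact mul_le_of_le_one_left hε.le (by linarith)
    _ ≤ _ := le_add_of_nonneg_right (by positivity)
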